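/- Let $\mathcal C([0,\cdot],\mathbb R^2)=\bigcup_{T\ge 0}\mathcal C([0,T],\mathbb R^2)$; for $f$ in this space write $t_f$ for its duration (so $f:[0,t_f]\to\mathbb R^2$) and $\mathrm{Range}(f)=f([0,t_f])$. Identify $\mathbb R^2$ with $\mathbb C$. Let $\mathcal S$ be the set of simple paths, i.e. of $\gamma\in\mathcal C([0,\cdot],\mathbb R^2)$ that are injective on $[0,t_\gamma]$, and let $\mathcal L$ be the set of loops, i.e. of $\ell\in\mathcal C([0,\cdot],\mathbb R^2)$ with $\ell(0)=\ell(t_\ell)$. Put $$d_\infty(f,g)=|t_f-t_g|+\sup_{t\ge0}|f(t\wedge t_f)-g(t\wedge t_g)|,$$ $$\rho(f,g)=\inf_{\varphi}\Big\{\|f-g\circ\varphi\|_{\infty,[0,t_f]}+\tfrac12\big(\|\varphi-\mathrm{Id}\|_{\infty,[0,t_f]}+\|\varphi^{-1}-\mathrm{Id}\|_{\infty,[0,t_g]}\big)\Big\},$$ where $\varphi$ ranges over the continuous increasing bijections from $[0,t_f]$ to $[0,t_g]$ (and $\inf\emptyset=\infty$). Endow $\mathcal S$ with the topology of $\rho$,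 $\mathcal L$ with the topology of $d_\infty$, and $\mathcal S\times\mathcal L$ with the product topology, i.e. the topology of $\rho\times d_\infty$. Let $\mathcal L_0$ be the set of the pairs $(\gamma,\ell)\in\mathcal S\times\mathcal L$ with $\mathrm{Range}(\gamma)\cap\mathrm{Range}(\ell)\ne\emptyset$. For $(\gamma,\ell)\in\mathcal L_0$ define the first hitting time $\sigma_{\gamma,\ell}=\min\{\sigma\in[0,t_\gamma]:\gamma(\sigma)\in\mathrm{Range}(\ell)\}$, the spatial root $x_{\gamma,\ell}=\gamma(\sigma_{\gamma,\ell})$, the set of temporal roots $\Theta_{\gamma,\ell}=\{t\in[0,t_\ell]:\ell(t)=x_{\gamma,\ell}\}$, and $\theta^-_{\gamma,\ell}=\min\Theta_{\gamma,\ell}$, $\theta^+_{\gamma,\ell}=\max\Theta_{\gamma,\ell}$. For $\gamma\in\mathcal S$ and $x\in\gamma((0,t_\gamma))$ let $r$ be the distance from $x$ to $\{\gamma(0),\gamma(t_\gamma)\}$ and let $C$ be the circle of centre $x$ and radius $r$. Let $\sigma^-$ be the last time before $\gamma^{-1}(x)$, and $\sigma^+$ the first time after $\gamma^{-1}(x)$,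 at which $\gamma$ is on $C$. Let $\eta$ be the simple closed curve formed by $\gamma|_{[\sigma^-,\sigma^+]}$ and the anticlockwise arc of $C$ from $\gamma(\sigma^+)$ to $\gamma(\sigma^-)$. Let $L(x)$ and $R(x)$ be the bounded and the unbounded connected component of the complement of the range of $\eta$. A pair $(\gamma,\ell)\in\mathcal L_0$ is called regular if * $\sigma_{\gamma,\ell}\notin\{0,t_\gamma\}$ and $\Theta_{\gamma,\ell}$ consists of a single element $\theta$; * for every $\epsilon>0$ there are $\theta^L,\theta^R\in[\theta-\epsilon,\theta+\epsilon]\cap[0,t_\ell]$ with $\ell(\theta^L)\in L(x_{\gamma,\ell})$ and $\ell(\theta^R)\in R(x_{\gamma,\ell})$. Let $\mathcal L_{reg}$ be the set of regular pairs. **Theorem 3.2.** 1. The set $\mathcal L_0$ is a neighbourhood of $\mathcal L_{reg}$ in $\mathcal S\times\mathcal L$: there is an open set $U\subset\mathcal S\times\mathcal L$ with $\mathcal L_{reg}\subset U\subset\mathcal L_0$. 2. The maps $(\gamma,\ell)\mapsto\sigma_{\gamma,\ell}$, $x_{\gamma,\ell}$, $\theta^-_{\gamma,\ell}$ and $\theta^+_{\gamma,\ell}$,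 all defined on $\mathcal L_0$, are continuous at every point of $\mathcal L_{reg}$ (as maps on $\mathcal L_0$, not only when restricted to $\mathcal L_{reg}$). -/

import Mathlib

open scoped ENNReal NNReal Topology

/-- A continuous planar curve of finite duration: an element of `⋃_{T ≥ 0} C([0, T], ℂ)`,
with the plane `ℝ²` identified with `ℂ`. -/
structure Curve where
  /-- the duration `t_f` of the curve `f` -/
  duration : ℝ
  duration_nonneg : 0 ≤ duration
  /-- the curve itself -/
  toMap : C(Set.Icc (0 : ℝ) duration, ℂ)

namespace Curve

/-- The value of the curve at time `s`, extended by constants outside `[0, t_f]`;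
for `s ≥ 0` this is `f (s ∧ t_f)`. -/
noncomputable def eval (f : Curve) (s : ℝ) : ℂ :=
  Set.IccExtend f.duration_nonneg f.toMap s

/-- The range of the curve. -/
def range (f : Curve) : Set ℂ := Set.range f.toMap

theorem continuous_eval (f : Curve) : Continuous f.eval :=
  f.toMap.continuous.Icc_extend'

theorem eval_of_mem (f : Curve) {s : ℝ} (hs : s ∈ Set.Icc 0 f.duration) :
    f.eval s = f.toMap ⟨s, hs⟩ :=
  Set.IccExtend_of_mem f.duration_nonneg f.toMap hs

/-- The distance `d_∞ (f, g) = |t_f - t_g| + sup_{t ≥ 0} |f (t ∧ t_f) - g (t ∧ t_g)|`. -/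
noncomputable def dInfty (f g : Curve) : ℝ≥0∞ :=
  edist f.duration g.duration + ⨆ t : ℝ≥0, edist (f.eval t) (g.eval t)

/-- The cost of the time change `φ` between `f` and `g`:
`‖f - g ∘ φ‖_∞ + (‖φ - Id‖_∞ + ‖φ⁻¹ - Id‖_∞) / 2`. -/
noncomputable def timeChangeCost (f g : Curve)
    (φ : Set.Icc (0 : ℝ) f.duration ≃o Set.Icc (0 : ℝ) g.duration) : ℝ≥0∞ :=
  (⨆ s, edist (f.toMap s) (g.toMap (φ s))) +
    ((⨆ s, edist (φ s : ℝ) (s : ℝ)) + ⨆ s, edist (φ.symm s : ℝ) (s : ℝ)) / 2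

/-- The distance `ρ`: the infimum of the costs of the (automatically continuous) increasing
bijections `φ : [0, t_f] → [0, t_g]`. The infimum is `∞` if there is no such bijection, which
happens only if exactly one of the two durations is zero. -/
noncomputable def rho (f g : Curve) : ℝ≥0∞ :=
  ⨅ φ : Set.Icc (0 : ℝ) f.duration ≃o Set.Icc (0 : ℝ) g.duration, timeChangeCost f g φ

theorem dInfty_self (f : Curve) : dInfty f f = 0 := by simp [dInfty]

theorem dInfty_comm (f g : Curve) : dInfty f g = dInfty g f := by
  simp [dInfty, edist_comm]

theorem dInfty_triangle (f g h : Curve) : dInfty f h ≤ dInfty f g + dInfty g h := by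
  unfold dInfty
  rw [add_add_add_comm]
  refine add_le_add (edist_triangle _ _ _) (iSup_le fun t => ?_)
  exact (edist_triangle _ (g.eval t) _).trans
    (add_le_add (le_iSup (fun t : ℝ≥0 => edist (f.eval t) (g.eval t)) t)
      (le_iSup (fun t : ℝ≥0 => edist (g.eval t) (h.eval t)) t))

theorem rho_self (f : Curve) : rho f f = 0 := by
  refine le_antisymm (iInf_le_of_le (OrderIso.refl _) ?_) zero_le
  simp [timeChangeCost]

theorem rho_le_swap (f g : Curve) : rho f g ≤ rho g f := by
  refine le_iInf fun φ => iInf_le_of_le φ.symm ?_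
  unfold timeChangeCost
  refine add_le_add (iSup_le fun s => ?_) (ENNReal.div_le_div_right ?_ 2)
  · refine le_trans (le_of_eq ?_)
      (le_iSup (fun s => edist (g.toMap s) (f.toMap (φ s))) (φ.symm s))
    simp [edist_comm]
  · rw [add_comm]
    simp

theorem rho_comm (f g : Curve) : rho f g = rho g f :=
  le_antisymm (rho_le_swap f g) (rho_le_swap g f)

theorem rho_triangle (f g h : Curve) : rho f h ≤ rho f g + rho g h := by
  unfold rho
  rw [ENNReal.iInf_add]
  refine le_iInf fun φ => ?_
  rw [ENNReal.add_iInf]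
  refine le_iInf fun ψ => iInf_le_of_le (φ.trans ψ) ?_
  unfold timeChangeCost
  rw [add_add_add_comm, ← ENNReal.add_div]
  refine add_le_add (iSup_le fun s => ?_) (ENNReal.div_le_div_right ?_ 2)
  · exact (edist_triangle _ (g.toMap (φ s)) _).trans (add_le_add
      (le_iSup (fun s => edist (f.toMap s) (g.toMap (φ s))) s)
      (le_iSup (fun s => edist (g.toMap s) (h.toMap (ψ s))) (φ s)))
  · rw [add_add_add_comm]
    refine add_le_add (iSup_le fun s => ?_) (iSup_le fun s => ?_)
    · rw [add_comm]
      exact (edist_triangle _ (φ s : ℝ) _).trans (add_le_add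
        (le_iSup (fun s => edist (ψ s : ℝ) (s : ℝ)) (φ s))
        (le_iSup (fun s => edist (φ s : ℝ) (s : ℝ)) s))
    · exact (edist_triangle _ (ψ.symm s : ℝ) _).trans (add_le_add
        (le_iSup (fun s => edist (φ.symm s : ℝ) (s : ℝ)) (ψ.symm s))
        (le_iSup (fun s => edist (ψ.symm s : ℝ) (s : ℝ)) s))

end Curve

/-- The set of simple paths: curves that are injective on `[0, t_γ]`. -/
def SimplePath : Type := {γ : Curve // Function.Injective γ.toMap}

/-- The set of loops: curves with `ℓ 0 = ℓ t_ℓ`. -/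
def Loop : Type := {l : Curve // l.eval 0 = l.eval l.duration}

/-- Simple paths carry the distance `ρ`. -/
noncomputable instance : PseudoEMetricSpace SimplePath where
  edist γ γ' := Curve.rho γ.1 γ'.1
  edist_self γ := Curve.rho_self γ.1
  edist_comm γ γ' := Curve.rho_comm γ.1 γ'.1
  edist_triangle γ γ' γ'' := Curve.rho_triangle γ.1 γ'.1 γ''.1

/-- Loops carry the distance `d_∞`. -/
noncomputable instance : PseudoEMetricSpace Loop where
  edist l l' := Curve.dInfty l.1 l'.1
  edist_self l := Curve.dInfty_self l.1
  edist_comm l l' := Curve.dInfty_comm l.1 l'.1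
  edist_triangle l l' l'' := Curve.dInfty_triangle l.1 l'.1 l''.1

/-- The anticlockwise closed arc from `a` to `b` along the circle with centre `c` through `a`
(meant for `a ≠ b` at the same positive distance from `c`; the angle `β` is then unique). -/
def ccwArc (c a b : ℂ) : Set ℂ :=
  {z | ∃ α β : ℝ, 0 ≤ α ∧ α ≤ β ∧ β < 2 * Real.pi ∧
    z = c + (a - c) * Complex.exp (α * Complex.I) ∧
    b = c + (a - c) * Complex.exp (β * Complex.I)}

namespace SimplePath

/-- The inverse `γ⁻¹ : Range γ → [0, t_γ]`. -/
noncomputable def inv (γ : SimplePath) (x : ℂ) : ℝ :=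
  Function.invFunOn γ.1.eval (Set.Icc 0 γ.1.duration) x

/-- `r(x) = d(x, {o, f})`, with `o` and `f` the two endpoints of `γ`. -/
noncomputable def radius (γ : SimplePath) (x : ℂ) : ℝ :=
  Metric.infDist x {γ.1.eval 0, γ.1.eval γ.1.duration}

/-- `σ_γ⁻(x)`: the last time before reaching `x` at which `γ` is on the circle of centre `x` and
radius `r(x)`. -/
noncomputable def entryTime (γ : SimplePath) (x : ℂ) : ℝ :=
  sSup {s | s ∈ Set.Icc 0 γ.1.duration ∧ s < γ.inv x ∧
    γ.1.eval s ∈ Metric.sphere x (γ.radius x)}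

/-- `σ_γ⁺(x)`: the first time after reaching `x` at which `γ` is on the circle of centre `x` and
radius `r(x)`. -/
noncomputable def exitTime (γ : SimplePath) (x : ℂ) : ℝ :=
  sInf {s | s ∈ Set.Icc 0 γ.1.duration ∧ γ.inv x < s ∧
    γ.1.eval s ∈ Metric.sphere x (γ.radius x)}

/-- The range of the simple closed curve `η`: the piece of `γ` between the times `σ_γ⁻(x)` and
`σ_γ⁺(x)`, closed by the anticlockwise arc of the circle from `γ(σ_γ⁺(x))` to `γ(σ_γ⁻(x))`. -/
def closedUp (γ : SimplePath) (x : ℂ) : Set ℂ :=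
  γ.1.eval '' Set.Icc (γ.entryTime x) (γ.exitTime x) ∪
    ccwArc x (γ.1.eval (γ.exitTime x)) (γ.1.eval (γ.entryTime x))

/-- The left side `L(x)`: the bounded connected component of the complement of `η`, that is,
the set of the points off `η` whose component is bounded. -/
def leftSide (γ : SimplePath) (x : ℂ) : Set ℂ :=
  {z | z ∉ γ.closedUp x ∧ Bornology.IsBounded (connectedComponentIn (γ.closedUp x)ᶜ z)}

/-- The right side `R(x)`: the unbounded connected component of the complement of `η`. -/
def rightSide (γ : SimplePath) (x : ℂ) : Set ℂ :=
  {z | z ∉ γ.closedUp x ∧ ¬ Bornology.IsBounded (connectedComponentIn (γ.closedUp x)ᶜ z)}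

end SimplePath

/-- The times at which `γ` is on the range of the loop. -/
def hittingTimes (γ : SimplePath) (l : Loop) : Set ℝ :=
  {s | s ∈ Set.Icc 0 γ.1.duration ∧ γ.1.eval s ∈ l.1.range}

/-- The first hitting time `σ_{γ, ℓ}` (a minimum for intersecting pairs, see below). -/
noncomputable def firstHit (γ : SimplePath) (l : Loop) : ℝ := sInf (hittingTimes γ l)

/-- The spatial root `x_{γ, ℓ} = γ(σ_{γ, ℓ})`. -/
noncomputable def spatialRoot (γ : SimplePath) (l : Loop) : ℂ := γ.1.eval (firstHit γ l)

/-- The set `Θ_{γ, ℓ}` of the temporal roots: the times at which the loop is at the spatial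
root. -/
def temporalRoots (γ : SimplePath) (l : Loop) : Set ℝ :=
  {t | t ∈ Set.Icc 0 l.1.duration ∧ l.1.eval t = spatialRoot γ l}

/-- The smallest temporal root `θ⁻_{γ, ℓ}`. -/
noncomputable def thetaMinus (γ : SimplePath) (l : Loop) : ℝ := sInf (temporalRoots γ l)

/-- The largest temporal root `θ⁺_{γ, ℓ}`. -/
noncomputable def thetaPlus (γ : SimplePath) (l : Loop) : ℝ := sSup (temporalRoots γ l)

/-- The simple path and the loop intersect. -/
def Intersects (γ : SimplePath) (l : Loop) : Prop := (l.1.range ∩ γ.1.range).Nonempty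

/-- The loop is regular for `γ`: it intersects `γ`, it visits the spatial root at a single time
`θ`, the first hitting time is neither `0` nor `t_γ`, and the loop reaches both sides of `γ` at
times (of its time interval) arbitrarily close to `θ`. -/
def IsRegularPair (γ : SimplePath) (l : Loop) : Prop :=
  Intersects γ l ∧ firstHit γ l ≠ 0 ∧ firstHit γ l ≠ γ.1.duration ∧
  ∃ θ : ℝ, temporalRoots γ l = {θ} ∧
    ∀ ε > 0,
      (∃ θL ∈ Set.Icc (θ - ε) (θ + ε) ∩ Set.Icc 0 l.1.duration,
        l.1.eval θL ∈ γ.leftSide (spatialRoot γ l)) ∧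
      (∃ θR ∈ Set.Icc (θ - ε) (θ + ε) ∩ Set.Icc 0 l.1.duration,
        l.1.eval θR ∈ γ.rightSide (spatialRoot γ l))

/-- The set `𝓛₀` of the intersecting pairs. -/
def intersectingPairs : Set (SimplePath × Loop) := {p | Intersects p.1 p.2}

/-- The set `𝓛_reg` of the regular pairs. -/
def regularPairs : Set (SimplePath × Loop) := {p | IsRegularPair p.1 p.2}

/-- For intersecting pairs the first hitting time is attained. -/
theorem isLeast_firstHit {γ : SimplePath} {l : Loop} (h : Intersects γ l) :
    IsLeast (hittingTimes γ l) (firstHit γ l) := by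
  have hc : IsCompact (hittingTimes γ l) :=
    isCompact_Icc.inter_right
      ((isCompact_range l.1.toMap.continuous).isClosed.preimage γ.1.continuous_eval)
  obtain ⟨x, hxl, s, hs⟩ := h
  refine hc.isLeast_sInf ⟨s, s.2, ?_⟩
  rw [γ.1.eval_of_mem s.2, hs]
  exact hxl

theorem isCompact_temporalRoots (γ : SimplePath) (l : Loop) :
    IsCompact (temporalRoots γ l) :=
  isCompact_Icc.inter_right (isClosed_singleton.preimage l.1.continuous_eval)

theorem temporalRoots_nonempty {γ : SimplePath} {l : Loop} (h : Intersects γ l) :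
    (temporalRoots γ l).Nonempty := by
  obtain ⟨t, ht⟩ := (isLeast_firstHit h).1.2
  exact ⟨t, t.2, by rw [l.1.eval_of_mem t.2, ht, spatialRoot]⟩

/-- For intersecting pairs there is a smallest temporal root. -/
theorem isLeast_thetaMinus {γ : SimplePath} {l : Loop} (h : Intersects γ l) :
    IsLeast (temporalRoots γ l) (thetaMinus γ l) :=
  (isCompact_temporalRoots γ l).isLeast_sInf (temporalRoots_nonempty h)

/-- For intersecting pairs there is a largest temporal root. -/
theorem isGreatest_thetaPlus {γ : SimplePath} {l : Loop} (h : Intersects γ l) :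
    IsGreatest (temporalRoots γ l) (thetaPlus γ l) :=
  (isCompact_temporalRoots γ l).isGreatest_sSup (temporalRoots_nonempty h)

/-! The only delicate point is that a loop crossing `γ` at the root still meets every path near `γ`
close to that place. The range `K` of `η` separates a point `p` of `L` visited by the loop just
before or after `θ` from such a point `q` of `R`. This separation is detected by logarithms: on `K`,
`z - q` has a continuous logarithm and `z - p` has none. Having a logarithm survives small
perturbations and is constant while the base point moves in a connected set off the curve. Hence the
image of `K` under a map close to the identity must meet the nearby loop's segment between the times
of `p` and `q` (`exists_mem_of_separates`). The Jordan curve theorem is not used: only boundedness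
or unboundedness of the components matters.

A path close to `γ` up to a time change is the image of `γ` under a small perturbation of the
identity, obtained by Tietze extension. The loop stays near the root around `θ`, so the intersection
is far from the arc and lies on the path, at a time near `σ` by injectivity
(`eventually_exists_hit`). This gives the neighbourhood and upper semicontinuity of `σ`. Lower
semicontinuity is compactness (`eventually_forall_lt_hit`). Continuity of the root follows through
the time change, and that of `θ⁻` and `θ⁺` from compactness and uniqueness of `θ`. -/

/-! ### Continuous logarithms and their homotopy invariance. -/

/-- The function `u` has a continuous logarithm on the set `K`. -/
def HasLogOn (K : Set ℂ) (u : ℂ → ℂ) : Prop :=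
  ∃ g : ℂ → ℂ, ContinuousOn g K ∧ ∀ z ∈ K, u z = Complex.exp (g z)

namespace HasLogOn

variable {K : Set ℂ} {u v : ℂ → ℂ}

theorem mono {K' : Set ℂ} (h : HasLogOn K u) (hK : K' ⊆ K) : HasLogOn K' u := by
  obtain ⟨g, hg, hu⟩ := h
  exact ⟨g, hg.mono hK, fun z hz => hu z (hK hz)⟩

theorem congr (h : HasLogOn K u) (huv : ∀ z ∈ K, v z = u z) : HasLogOn K v := by
  obtain ⟨g, hg, hu⟩ := h
  exact ⟨g, hg, fun z hz => (huv z hz).trans (hu z hz)⟩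

theorem const {c : ℂ} (hc : c ≠ 0) : HasLogOn K fun _ => c :=
  ⟨fun _ => Complex.log c, continuousOn_const, fun _ _ => (Complex.exp_log hc).symm⟩

/-- Having a continuous logarithm is stable under small perturbations. -/
theorem of_norm_sub_lt (h : HasLogOn K u) (hu : ContinuousOn u K) (hv : ContinuousOn v K)
    (huv : ∀ z ∈ K, ‖v z - u z‖ < ‖u z‖) : HasLogOn K v := by
  obtain ⟨g, hg, hgu⟩ := h
  have hu0 : ∀ z ∈ K, u z ≠ 0 := fun z hz => by
    rw [hgu z hz]
    exact Complex.exp_ne_zero _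
  -- The quotient lies in the disc of radius 1 about 1, where the principal logarithm is continuous.
  have hslit : ∀ z ∈ K, v z / u z ∈ Complex.slitPlane := fun z hz => by
    have h1 : ‖(v z - u z) / u z‖ < 1 := by
      rw [norm_div, div_lt_one (norm_pos_iff.2 (hu0 z hz))]
      exact huv z hz
    have h2 := Complex.mem_slitPlane_of_norm_lt_one h1
    rwa [sub_div, div_self (hu0 z hz), add_sub_cancel] at h2
  refine ⟨fun z => g z + Complex.log (v z / u z), hg.add ((hv.div hu hu0).clog hslit),
    fun z hz => ?_⟩
  rw [Complex.exp_add, ← hgu z hz, Complex.exp_log (Complex.slitPlane_ne_zero (hslit z hz)),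
    mul_div_cancel₀ _ (hu0 z hz)]

/-- Having a continuous logarithm is constant along a connected family of functions without
zeros that is locally uniformly continuous in the parameter. -/
theorem of_isPreconnected {X : Type*} [TopologicalSpace X] {S : Set X} (hS : IsPreconnected S)
    {H : X → ℂ → ℂ} (hH : ∀ w ∈ S, ContinuousOn (H w) K)
    (hclose : ∀ w ∈ S, ∀ᶠ w' in 𝓝[S] w, ∀ z ∈ K,
      ‖H w' z - H w z‖ < ‖H w z‖ ∧ ‖H w' z - H w z‖ < ‖H w' z‖)
    {a b : X} (ha : a ∈ S) (hb : b ∈ S) (h : HasLogOn K (H a)) : HasLogOn K (H b) := by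
  -- Induction on a connected set needs the local relation in both directions, hence the two
  -- inequalities in `hclose`.
  refine hS.induction₂' (fun x y => HasLogOn K (H x) → HasLogOn K (H y)) (fun w hw => ?_)
    (fun x y z _ _ _ h₁ h₂ h => h₂ (h₁ h)) ha hb h
  filter_upwards [hclose w hw, self_mem_nhdsWithin] with w' hw' hwS
  refine ⟨fun h => h.of_norm_sub_lt (hH w hw) (hH w' hwS) fun z hz => (hw' z hz).1,
    fun h => h.of_norm_sub_lt (hH w' hwS) (hH w hw) fun z hz => ?_⟩
  rw [norm_sub_rev]
  exact (hw' z hz).2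

/-- Whether `f - w` has a continuous logarithm on a compact set does not change when `w` moves in
a connected set that avoids the image of `f`. -/
theorem sub_const_of_isPreconnected (hK : IsCompact K) {f : ℂ → ℂ} (hf : ContinuousOn f K)
    {S : Set ℂ} (hS : IsPreconnected S) (hdisj : ∀ z ∈ K, f z ∉ S) {a b : ℂ} (ha : a ∈ S)
    (hb : b ∈ S) (h : HasLogOn K fun z => f z - a) : HasLogOn K fun z => f z - b := by
  refine of_isPreconnected hS (H := fun w z => f z - w) (fun w _ => hf.sub continuousOn_const)
    (fun w hw => ?_) ha hb h
  have hcl : IsClosed (f '' K) := (hK.image_of_continuousOn hf).isClosed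
  have hwK : w ∈ (f '' K)ᶜ := by
    rintro ⟨z, hz, rfl⟩
    exact hdisj z hz hw
  obtain ⟨d, hd, hball⟩ := Metric.isOpen_iff.1 hcl.isOpen_compl w hwK
  filter_upwards [mem_nhdsWithin_of_mem_nhds (Metric.ball_mem_nhds w (half_pos hd))] with w' hw' z hz
  have h1 : d ≤ ‖f z - w‖ := by
    by_contra hlt
    exact hball (by simpa [dist_eq_norm] using hlt) ⟨z, hz, rfl⟩
  rw [Metric.mem_ball, dist_eq_norm] at hw'
  have h2 : ‖f z - w' - (f z - w)‖ = ‖w' - w‖ := by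
    rw [← norm_neg]
    congr 1
    ring
  have h3 : ‖f z - w‖ ≤ ‖f z - w'‖ + ‖w' - w‖ := by
    simpa using norm_add_le (f z - w') (w' - w)
  constructor <;> linarith

/-- A continuous function without zeros on a closed disc has a continuous logarithm. -/
theorem closedBall {R : ℝ} (hR : 0 < R) (hu : ContinuousOn u (Metric.closedBall 0 R))
    (hu0 : ∀ z ∈ Metric.closedBall (0 : ℂ) R, u z ≠ 0) : HasLogOn (Metric.closedBall 0 R) u := by
  have hmem : ∀ r ∈ Set.Icc (0 : ℝ) 1, ∀ z ∈ Metric.closedBall (0 : ℂ) R,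
      r • z ∈ Metric.closedBall (0 : ℂ) R := fun r hr z hz => by
    rw [mem_closedBall_zero_iff] at hz ⊢
    rw [norm_smul, Real.norm_of_nonneg hr.1]
    nlinarith [norm_nonneg z, hr.2]
  have hK : IsCompact (Metric.closedBall (0 : ℂ) R) := isCompact_closedBall _ _
  obtain ⟨m, hm, hmu⟩ : ∃ m > 0, ∀ z ∈ Metric.closedBall (0 : ℂ) R, m ≤ ‖u z‖ := by
    obtain ⟨z, hz, hmin⟩ := hK.exists_isMinOn ⟨0, by simp [hR.le]⟩ hu.norm
    exact ⟨‖u z‖, norm_pos_iff.2 (hu0 z hz), fun y hy => hmin hy⟩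
  have huc := Metric.uniformContinuousOn_iff.1 (hK.uniformContinuousOn_of_continuous hu)
  obtain ⟨δ, hδ, hδu⟩ := huc m hm
  -- The homotopy `u (r • z)` contracts `u` to the constant `u 0`.
  have key := of_isPreconnected (K := Metric.closedBall 0 R) (isPreconnected_Icc (a := (0 : ℝ))
    (b := 1)) (H := fun r z => u (r • z))
    (fun r hr => hu.comp (by fun_prop) fun z hz => hmem r hr z hz) (fun r hr => ?_)
    (Set.left_mem_Icc.2 zero_le_one) (Set.right_mem_Icc.2 zero_le_one)
    ((HasLogOn.const (hu0 0 (by simp [hR.le]))).congr fun z _ => by simp)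
  · exact key.congr fun z _ => by simp
  · filter_upwards [mem_nhdsWithin_of_mem_nhds (Metric.ball_mem_nhds r (div_pos hδ hR)),
      self_mem_nhdsWithin] with r' hr' hr'I z hz
    have hlt : ‖u (r' • z) - u (r • z)‖ < m := by
      rw [← dist_eq_norm]
      refine hδu _ (hmem r' hr'I z hz) _ (hmem r hr z hz) ?_
      rw [Metric.mem_ball, Real.dist_eq, lt_div_iff₀ hR] at hr'
      rw [dist_eq_norm, ← sub_smul, norm_smul, Real.norm_eq_abs]
      exact (mul_le_mul_of_nonneg_left (mem_closedBall_zero_iff.1 hz) (abs_nonneg _)).trans_lt hr'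
    exact ⟨hlt.trans_le (hmu _ (hmem r hr z hz)), hlt.trans_le (hmu _ (hmem r' hr'I z hz))⟩

end HasLogOn

/-! ### Separation of the plane by compact sets, through logarithms. -/

/-- The identity has no continuous logarithm on a circle around the origin. -/
theorem not_hasLogOn_sphere {R : ℝ} (hR : 0 < R) :
    ¬ HasLogOn (Metric.sphere 0 R) fun z => z := by
  rintro ⟨g, hg, hexp⟩
  have hmem : ∀ t : ℝ, (R : ℂ) * Complex.exp (t * Complex.I) ∈ Metric.sphere (0 : ℂ) R :=
    fun t => by simp [Complex.norm_exp_ofReal_mul_I, abs_of_pos hR]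
  -- Subtracting the angle makes `h` a logarithm of the constant `R`, yet `h` drops by `2πi` over
  -- one turn. At an intermediate time the drop is `πi`, which would give `R = -R`.
  set h : ℝ → ℂ := fun t => g (R * Complex.exp (t * Complex.I)) - t * Complex.I with hh
  have hcont : Continuous h :=
    (hg.comp_continuous (by fun_prop) hmem).sub (by fun_prop)
  have hR' : (R : ℂ) ≠ 0 := by exact_mod_cast hR.ne'
  have hexpR : ∀ t, Complex.exp (h t) = R := fun t => by
    rw [hh, Complex.exp_sub, ← hexp _ (hmem t), mul_div_assoc, div_self (Complex.exp_ne_zero _),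
      mul_one]
  have hend : h (2 * Real.pi) = h 0 - 2 * Real.pi * Complex.I := by
    simp [hh]
  obtain ⟨t, ht⟩ : (h 0).im - Real.pi ∈ Set.range fun t => (h t).im := by
    refine mem_range_of_exists_le_of_exists_ge (Complex.continuous_im.comp hcont)
      ⟨2 * Real.pi, ?_⟩ ⟨0, ?_⟩
    · have := congrArg Complex.im hend
      simp at this
      linarith [Real.pi_pos, this]
    · simpa using Real.pi_pos.le
  have hre : ∀ s, (h s).re = Real.log R := fun s => by
    have := congrArg norm (hexpR s)
    rw [Complex.norm_exp, Complex.norm_real, Real.norm_of_nonneg hR.le] at this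
    rw [← this, Real.log_exp]
  have heq : h t = h 0 - Real.pi * Complex.I := by
    apply Complex.ext
    · simp [hre]
    · simpa using ht
  have h1 := hexpR t
  rw [heq, Complex.exp_sub, hexpR 0, Complex.exp_pi_mul_I, div_neg, div_one] at h1
  exact hR' (by linear_combination (-1 / 2 : ℂ) * h1)

/-- The points of the frontier of a component of an open set are outside the open set. -/
theorem frontier_connectedComponentIn_subset {U : Set ℂ} (hU : IsOpen U) (p : ℂ) :
    frontier (connectedComponentIn U p) ⊆ Uᶜ := by
  intro y hy hyU
  have hopen : IsOpen (connectedComponentIn U p) := hU.connectedComponentIn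
  rw [hopen.frontier_eq] at hy
  obtain ⟨w, hw, hwp⟩ := mem_closure_iff.1 hy.1 _ (hU.connectedComponentIn (x := y))
    (mem_connectedComponentIn hyU)
  refine hy.2 ?_
  rw [connectedComponentIn_eq hwp, ← connectedComponentIn_eq hw]
  exact mem_connectedComponentIn hyU

/-- If `p` lies in a bounded component of the complement of the compact set `K`, then `z - p` has
no continuous logarithm on `K`. -/
theorem not_hasLogOn_of_isBounded {K : Set ℂ} (hK : IsCompact K) {p : ℂ} (hp : p ∉ K)
    (hb : Bornology.IsBounded (connectedComponentIn Kᶜ p)) :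
    ¬ HasLogOn K fun z => z - p := by
  classical
  rintro ⟨g, hg, hexp⟩
  obtain ⟨G, hG⟩ := ContinuousMap.exists_restrict_eq hK.isClosed ⟨K.domRestrict g, hg.domRestrict⟩
  have hGg : ∀ z ∈ K, G z = g z := fun z hz => congrArg (fun f => f ⟨z, hz⟩) hG
  set U := connectedComponentIn Kᶜ p with hUdef
  have hpU : p ∈ U := mem_connectedComponentIn hp
  -- A logarithm on `K` allows `z - p` to be replaced inside `U` by a function without zeros. The
  -- pieces agree on the frontier of `U`, which lies in `K`.
  set F : ℂ → ℂ := fun z => if z ∈ U then Complex.exp (G z) else z - p with hF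
  have hFc : Continuous F := by
    refine Continuous.if (fun a ha => ?_) (by fun_prop) (by fun_prop)
    have haK : a ∈ K := by
      simpa using frontier_connectedComponentIn_subset hK.isClosed.isOpen_compl p ha
    rw [hGg a haK, ← hexp a haK]
  have hF0 : ∀ z, F z ≠ 0 := fun z => by
    by_cases hz : z ∈ U
    · simp [hF, hz]
    · simp only [hF, hz, if_false]
      exact sub_ne_zero.2 fun h => hz (h ▸ hpU)
  -- The sphere of radius `R` avoids `U`, so `F` is `z - p` there, and `2 * ‖p‖ < R` makes `z` a
  -- small perturbation of `z - p`.
  obtain ⟨R, hRpos, hR⟩ : ∃ R : ℝ, 2 * ‖p‖ < R ∧ U ⊆ Metric.ball 0 R := by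
    obtain ⟨R, hR⟩ := hb.subset_ball (0 : ℂ)
    exact ⟨max R (2 * ‖p‖ + 1), by simp, hR.trans (Metric.ball_subset_ball (le_max_left _ _))⟩
  have hR0 : 0 < R := by linarith [norm_nonneg p]
  have hlog : HasLogOn (Metric.sphere 0 R) fun z => z - p := by
    refine ((HasLogOn.closedBall hR0 hFc.continuousOn fun z _ => hF0 z).mono
      Metric.sphere_subset_closedBall).congr fun z hz => ?_
    have hzU : z ∉ U := fun h => by
      have h1 := hR h
      rw [mem_ball_zero_iff] at h1
      rw [mem_sphere_zero_iff_norm] at hz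
      linarith
    simp [hF, hzU]
  refine not_hasLogOn_sphere hR0
    (hlog.of_norm_sub_lt (by fun_prop) (by fun_prop) fun z hz => ?_)
  rw [mem_sphere_zero_iff_norm] at hz
  rw [sub_sub_cancel]
  linarith [norm_sub_norm_le z p]

/-- If `q` lies in an unbounded component of the complement of the compact set `K`, then `z - q`
has a continuous logarithm on `K`. -/
theorem hasLogOn_of_not_isBounded {K : Set ℂ} (hK : IsCompact K) {q : ℂ} (hq : q ∉ K)
    (hb : ¬ Bornology.IsBounded (connectedComponentIn Kᶜ q)) :
    HasLogOn K fun z => z - q := by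
  obtain ⟨R, hR⟩ := hK.isBounded.subset_ball (0 : ℂ)
  -- For `w` far away in the component, `z - w` is a perturbation of the nonzero constant `-w`; then
  -- `w` is moved back to `q`.
  obtain ⟨w, hw, hwR⟩ : ∃ w ∈ connectedComponentIn Kᶜ q, w ∉ Metric.ball (0 : ℂ) (max R 1) := by
    by_contra! hcon
    exact hb (Metric.isBounded_ball.subset hcon)
  rw [mem_ball_zero_iff, not_lt, max_le_iff] at hwR
  have hw0 : -w ≠ 0 := neg_ne_zero.2 (norm_pos_iff.1 (by linarith))
  have hlog : HasLogOn K fun z => z - w := by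
    refine (HasLogOn.const hw0).of_norm_sub_lt continuousOn_const (by fun_prop) fun z hz => ?_
    have := mem_ball_zero_iff.1 (hR hz)
    rw [sub_neg_eq_add, sub_add_cancel, norm_neg]
    linarith
  exact hlog.sub_const_of_isPreconnected hK continuousOn_id isPreconnected_connectedComponentIn
    (fun z hz h => connectedComponentIn_subset Kᶜ q h hz) hw (mem_connectedComponentIn hq)

/-- Separation by a compact set is stable: if `p` lies in a bounded and `q` in an unbounded
component of the complement of the compact set `K`, then the image of `K` under a small
perturbation of the identity meets every connected set joining points close to `p` and `q`. -/
theorem exists_mem_of_separates {K : Set ℂ} (hK : IsCompact K) {p q : ℂ} (hp : p ∉ K) (hq : q ∉ K)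
    (hpb : Bornology.IsBounded (connectedComponentIn Kᶜ p))
    (hqb : ¬ Bornology.IsBounded (connectedComponentIn Kᶜ q))
    {f : ℂ → ℂ} (hf : ContinuousOn f K) {S : Set ℂ} (hS : IsPreconnected S) {p' q' : ℂ}
    (hp' : p' ∈ S) (hq' : q' ∈ S)
    (hfp : ∀ z ∈ K, 2 * (‖f z - z‖ + ‖p' - p‖) < ‖z - p‖)
    (hfq : ∀ z ∈ K, 2 * (‖f z - z‖ + ‖q' - q‖) < ‖z - q‖) :
    ∃ z ∈ K, f z ∈ S := by
  by_contra! hcon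
  have hsub : ∀ z w w', ‖f z - w' - (z - w)‖ ≤ ‖f z - z‖ + ‖w' - w‖ := fun z w w' => by
    rw [sub_sub_sub_comm]
    -- Below, the logarithm passes from `z - q` to `f z - q'`, along `S` to `f z - p'`, and back to
    -- `z - p`. The factor 2 in `hfp` serves this last comparison, whose error is measured against
    -- the perturbed function.
    exact norm_sub_le _ _
  have h1 : HasLogOn K fun z => f z - q' :=
    (hasLogOn_of_not_isBounded hK hq hqb).of_norm_sub_lt (by fun_prop)
      (hf.sub continuousOn_const) fun z hz => by
        linarith [hsub z q q', hfq z hz, norm_nonneg (f z - q' - (z - q))]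
  have h2 : HasLogOn K fun z => f z - p' :=
    h1.sub_const_of_isPreconnected hK hf hS hcon hq' hp'
  refine not_hasLogOn_of_isBounded hK hp hpb (h2.of_norm_sub_lt (hf.sub continuousOn_const)
    (by fun_prop) fun z hz => ?_)
  rw [norm_sub_rev]
  linarith [hsub z p p', hfp z hz, norm_sub_norm_le (z - p) (f z - p'),
    norm_sub_rev (z - p) (f z - p')]

/-! ### Compactness of arcs and paths. -/

namespace Curve

theorem eval_mem_range (f : Curve) (s : ℝ) : f.eval s ∈ f.range := Set.mem_range_self _

theorem eval_coe (f : Curve) (s : Set.Icc (0 : ℝ) f.duration) : f.eval s = f.toMap s :=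
  f.eval_of_mem s.2

theorem eval_eq_toMap_projIcc (f : Curve) (s : ℝ) :
    f.eval s = f.toMap (Set.projIcc 0 f.duration f.duration_nonneg s) := rfl

theorem eval_min (f : Curve) {s : ℝ} (hs : 0 ≤ s) : f.eval (min s f.duration) = f.eval s := by
  rw [eval_eq_toMap_projIcc, eval_eq_toMap_projIcc]
  congr 1
  ext
  simp [Set.projIcc, f.duration_nonneg, hs, min_comm]

theorem isCompact_range (f : Curve) : IsCompact f.range :=
  _root_.isCompact_range f.toMap.continuous

end Curve

/-- The angle `β` is unique in `[0, 2π)`, so the arc is the image of a single interval; if `b` is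
off the circle, the arc is empty. -/
theorem isCompact_ccwArc {c a b : ℂ} (hac : a ≠ c) : IsCompact (ccwArc c a b) := by
  by_cases h : ∃ β : ℝ, 0 ≤ β ∧ β < 2 * Real.pi ∧
      b = c + (a - c) * Complex.exp (β * Complex.I)
  · obtain ⟨β, hβ0, hβ, hb⟩ := h
    have heq : ccwArc c a b =
        (fun α : ℝ => c + (a - c) * Complex.exp (α * Complex.I)) '' Set.Icc 0 β := by
      ext z
      constructor
      · rintro ⟨α, β', h0, hαβ, hβ', rfl, hb'⟩
        have hexp : Complex.exp (β' * Complex.I) = Complex.exp (β * Complex.I) :=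
          mul_left_cancel₀ (sub_ne_zero.2 hac) (add_left_cancel (hb'.symm.trans hb))
        have hββ : β' = β := by
          obtain ⟨n, hn⟩ := Complex.exp_eq_exp_iff_exists_int.1 hexp
          have hn' : β' = β + n * (2 * Real.pi) := by
            have := congrArg Complex.im hn
            simpa using this
          have hpi := Real.pi_pos
          have h1 : (n : ℝ) < 1 := by
            by_contra! hcon
            nlinarith
          have h2 : (-1 : ℝ) < n := by
            by_contra! hcon
            nlinarith
          have h3 : n = 0 := by
            have h1' : n < 1 := by exact_mod_cast h1
            have h2' : -1 < n := by exact_mod_cast h2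
            lia
          simpa [h3] using hn'
        exact ⟨α, ⟨h0, hββ ▸ hαβ⟩, rfl⟩
      · rintro ⟨α, hα, rfl⟩
        exact ⟨α, β, hα.1, hα.2, hβ, rfl, hb⟩
    rw [heq]
    exact isCompact_Icc.image (by fun_prop)
  · have heq : ccwArc c a b = ∅ := by
      rw [Set.eq_empty_iff_forall_notMem]
      rintro z ⟨α, β, h0, hαβ, hβ, -, hb⟩
      exact h ⟨β, h0.trans hαβ, hβ, hb⟩
    rw [heq]
    exact isCompact_empty

theorem norm_sub_of_mem_ccwArc {c a b z : ℂ} (hz : z ∈ ccwArc c a b) : ‖z - c‖ = ‖a - c‖ := by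
  obtain ⟨α, β, -, -, -, rfl, -⟩ := hz
  simp [Complex.norm_exp_ofReal_mul_I]

namespace SimplePath

variable (γ : SimplePath)

theorem isClosedEmbedding_toMap : Topology.IsClosedEmbedding γ.1.toMap :=
  γ.1.toMap.continuous.isClosedEmbedding γ.2

theorem eval_injOn : Set.InjOn γ.1.eval (Set.Icc 0 γ.1.duration) := by
  intro s hs t ht h
  rw [γ.1.eval_of_mem hs, γ.1.eval_of_mem ht] at h
  exact congrArg Subtype.val (γ.2 h)

/-- The exit point lies on a closed sphere of positive radius. If the path never meets that sphere
after `x`, the infimum defaults to `0`, and `γ(0) ≠ x` suffices. This keeps the closing arc away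
from `x`. -/
theorem eval_exitTime_ne {x : ℂ} (h0 : γ.1.eval 0 ≠ x) (h1 : γ.1.eval γ.1.duration ≠ x) :
    γ.1.eval (γ.exitTime x) ≠ x := by
  have hr : 0 < γ.radius x := by
    refine ((Set.toFinite _).isClosed.notMem_iff_infDist_pos (Set.insert_nonempty _ _)).1 ?_
    simp [h0.symm, h1.symm]
  rcases Set.eq_empty_or_nonempty {s | s ∈ Set.Icc 0 γ.1.duration ∧ γ.inv x < s ∧
      γ.1.eval s ∈ Metric.sphere x (γ.radius x)} with h | h
  · rwa [exitTime, h, Real.sInf_empty]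
  · have hmem := csInf_mem_closure h ⟨0, fun s hs => hs.1.1⟩
    have hsph : γ.1.eval (γ.exitTime x) ∈ Metric.sphere x (γ.radius x) :=
      closure_minimal (fun s hs => hs.2.2) (Metric.isClosed_sphere.preimage γ.1.continuous_eval)
        hmem
    intro heq
    rw [heq, Metric.mem_sphere, dist_self] at hsph
    exact hr.ne hsph

theorem isCompact_closedUp {x : ℂ} (h : γ.1.eval (γ.exitTime x) ≠ x) :
    IsCompact (γ.closedUp x) :=
  (isCompact_Icc.image γ.1.continuous_eval).union (isCompact_ccwArc h)

/-- Times at which an injective path is close to one of its points are close to the time of that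
point. -/
theorem exists_forall_norm_lt_imp {σ : ℝ} (hσ : σ ∈ Set.Icc 0 γ.1.duration) {ε : ℝ} (hε : 0 < ε) :
    ∃ δ > 0, ∀ s ∈ Set.Icc 0 γ.1.duration, ‖γ.1.eval s - γ.1.eval σ‖ < δ → |s - σ| < ε := by
  have hc : IsCompact (Set.Icc 0 γ.1.duration ∩ {s | ε ≤ |s - σ|}) :=
    isCompact_Icc.inter_right (isClosed_le continuous_const (by fun_prop))
  have hx : γ.1.eval σ ∉ γ.1.eval '' (Set.Icc 0 γ.1.duration ∩ {s | ε ≤ |s - σ|}) := by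
    rintro ⟨s, ⟨hs, hsε⟩, h⟩
    rw [γ.eval_injOn hs hσ h] at hsε
    simp at hsε
    linarith
  obtain ⟨δ, hδ, hball⟩ := Metric.isOpen_iff.1
    (hc.image γ.1.continuous_eval).isClosed.isOpen_compl _ hx
  refine ⟨δ, hδ, fun s hs hlt => ?_⟩
  by_contra! hcon
  exact hball (by rwa [Metric.mem_ball, dist_eq_norm]) ⟨s, ⟨hs, hcon⟩, rfl⟩

end SimplePath

/-! ### Neighbourhoods in terms of uniform closeness. -/

/-- Two curves are `κ`-close along the time change `φ`, which moves times by less than `κ`. -/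
structure Curve.CloseAlong (κ : ℝ) (f g : Curve)
    (φ : Set.Icc (0 : ℝ) f.duration ≃o Set.Icc (0 : ℝ) g.duration) : Prop where
  norm_sub_lt : ∀ s, ‖g.toMap (φ s) - f.toMap s‖ < κ
  abs_sub_lt : ∀ s, |(φ s : ℝ) - s| < κ

/-- Two curves are `κ`-close at all times, and so are their durations. -/
structure Curve.Close (κ : ℝ) (f g : Curve) : Prop where
  norm_sub_lt : ∀ t, 0 ≤ t → ‖g.eval t - f.eval t‖ < κ
  abs_sub_lt : |g.duration - f.duration| < κ

/-- The bound `κ / 2` compensates for the weight 1/2 that `rho` gives to time displacements. -/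
theorem Curve.exists_closeAlong_of_rho_lt {κ : ℝ} {f g : Curve}
    (h : Curve.rho f g < ENNReal.ofReal (κ / 2)) : ∃ φ, Curve.CloseAlong κ f g φ := by
  obtain ⟨φ, hφ⟩ := iInf_lt_iff.1 h
  have hκ : 0 < κ / 2 := ENNReal.ofReal_pos.1 (zero_le.trans_lt h)
  refine ⟨φ, fun s => ?_, fun s => ?_⟩
  · have h1 : edist (f.toMap s) (g.toMap (φ s)) < ENNReal.ofReal (κ / 2) :=
      ((le_iSup (fun s => edist (f.toMap s) (g.toMap (φ s))) s).trans le_self_add).trans_lt hφ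
    rw [edist_lt_ofReal, dist_eq_norm, norm_sub_rev] at h1
    linarith
  · have h1 : edist (φ s : ℝ) (s : ℝ) / 2 < ENNReal.ofReal (κ / 2) :=
      ((ENNReal.div_le_div_right ((le_iSup (fun s => edist (φ s : ℝ) (s : ℝ)) s).trans
        le_self_add) 2).trans le_add_self).trans_lt hφ
    rw [ENNReal.ofReal_div_of_pos two_pos, ENNReal.ofReal_ofNat,
      ENNReal.div_lt_div_iff_left (by simp) (by simp), edist_lt_ofReal, Real.dist_eq] at h1
    exact h1

theorem Curve.close_of_dInfty_lt {κ : ℝ} {f g : Curve}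
    (h : Curve.dInfty f g < ENNReal.ofReal κ) : Curve.Close κ f g := by
  refine ⟨fun t ht => ?_, ?_⟩
  · have h1 : edist (f.eval t) (g.eval t) < ENNReal.ofReal κ :=
      ((le_iSup (fun t : ℝ≥0 => edist (f.eval t) (g.eval t)) ⟨t, ht⟩).trans
        le_add_self).trans_lt h
    rwa [edist_lt_ofReal, dist_eq_norm, norm_sub_rev] at h1
  · have h1 : edist f.duration g.duration < ENNReal.ofReal κ := le_self_add.trans_lt h
    rwa [edist_lt_ofReal, Real.dist_eq, abs_sub_comm] at h1

theorem eventually_close (p : SimplePath × Loop) {κ : ℝ} (hκ : 0 < κ) :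
    ∀ᶠ q in 𝓝 p, (∃ φ, Curve.CloseAlong κ p.1.1 q.1.1 φ) ∧ Curve.Close κ p.2.1 q.2.1 := by
  have h1 : ∀ᶠ γ in 𝓝 p.1, ∃ φ, Curve.CloseAlong κ p.1.1 γ.1 φ := by
    filter_upwards [Metric.eball_mem_nhds p.1 (ENNReal.ofReal_pos.2 (half_pos hκ))] with γ hγ
    rw [Metric.mem_eball'] at hγ
    exact Curve.exists_closeAlong_of_rho_lt hγ
  have h2 : ∀ᶠ l in 𝓝 p.2, Curve.Close κ p.2.1 l.1 := by
    filter_upwards [Metric.eball_mem_nhds p.2 (ENNReal.ofReal_pos.2 hκ)] with l hl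
    rw [Metric.mem_eball'] at hl
    exact Curve.close_of_dInfty_lt hl
  rw [nhds_prod_eq]
  exact h1.prod_mk h2

/-! ### Persistence of the hit and semicontinuity of the first hitting time. -/

/-- Near a regular pair, the path hits the loop at a time close to the first hitting time. -/
theorem eventually_exists_hit {p : SimplePath × Loop} (hp : p ∈ regularPairs) {ε : ℝ}
    (hε : 0 < ε) :
    ∀ᶠ q in 𝓝 p, ∃ s ∈ hittingTimes q.1 q.2, |s - firstHit p.1 p.2| < ε := by
  obtain ⟨γ, l⟩ := p
  obtain ⟨hint, hσ0, hσT, θ, hθ, hreg⟩ := hp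
  set σ := firstHit γ l with hσdef
  have hσ : σ ∈ Set.Icc 0 γ.1.duration := (isLeast_firstHit hint).1.1
  set x := spatialRoot γ l with hxdef
  have hxσ : γ.1.eval σ = x := rfl
  have hexit : γ.1.eval (γ.exitTime x) ≠ x := by
    refine γ.eval_exitTime_ne (fun h => hσ0 ?_) fun h => hσT ?_
    · exact (γ.eval_injOn (Set.left_mem_Icc.2 γ.1.duration_nonneg) hσ h).symm
    · exact (γ.eval_injOn (Set.right_mem_Icc.2 γ.1.duration_nonneg) hσ h).symm
  have hK := γ.isCompact_closedUp hexit
  have hlθ : l.1.eval θ = x := (hθ.symm ▸ Set.mem_singleton θ : θ ∈ temporalRoots γ l).2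
  obtain ⟨δ₁, hδ₁, hδσ⟩ := γ.exists_forall_norm_lt_imp hσ (half_pos hε)
  -- The point `z` found below is within `3 * δ` of `x`: one `δ` each for the loop near `θ`, the
  -- change of loop and the change of path. The two bounds on `3 * δ` put the time of `z` near `σ`
  -- and exclude the arc.
  obtain ⟨δ, hδ, hδ1, hδ2⟩ : ∃ δ > 0, 3 * δ ≤ δ₁ ∧ 3 * δ ≤ ‖γ.1.eval (γ.exitTime x) - x‖ := by
    have h2 : 0 < ‖γ.1.eval (γ.exitTime x) - x‖ := norm_pos_iff.2 (sub_ne_zero.2 hexit)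
    refine ⟨min δ₁ ‖γ.1.eval (γ.exitTime x) - x‖ / 3, div_pos (lt_min hδ₁ h2) three_pos, ?_, ?_⟩
    · rw [mul_div_cancel₀ _ three_ne_zero]
      exact min_le_left _ _
    · rw [mul_div_cancel₀ _ three_ne_zero]
      exact min_le_right _ _
  obtain ⟨ε₁, hε₁, hlδ⟩ := Metric.continuousAt_iff.1 l.1.continuous_eval.continuousAt δ hδ
  obtain ⟨⟨a, ⟨ha, ha0⟩, haL⟩, b, ⟨hb, hb0⟩, hbR⟩ := hreg (ε₁ / 2) (half_pos hε₁)
  have hdist : ∀ w, w ∉ γ.closedUp x → ∃ m > 0, ∀ z ∈ γ.closedUp x, m ≤ ‖z - w‖ := fun w hw => by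
    obtain ⟨m, hm, hball⟩ := Metric.isOpen_iff.1 hK.isClosed.isOpen_compl w hw
    refine ⟨m, hm, fun z hz => ?_⟩
    by_contra! hcon
    exact hball (by rwa [Metric.mem_ball, dist_eq_norm]) hz
  obtain ⟨m₁, hm₁, hm₁K⟩ := hdist _ haL.1
  obtain ⟨m₂, hm₂, hm₂K⟩ := hdist _ hbR.1
  -- Path and loop errors are each at most `κ`, so `exists_mem_of_separates` needs `4 * κ` below the
  -- distances `m₁` and `m₂` to the curve.
  obtain ⟨κ, hκ, hκδ, hκε, hκ₁, hκ₂⟩ : ∃ κ > 0, κ ≤ δ ∧ κ ≤ ε / 2 ∧ 5 * κ ≤ m₁ ∧ 5 * κ ≤ m₂ := by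
    refine ⟨min (min δ (ε / 2)) (min m₁ m₂ / 5), by positivity, ?_, ?_, ?_, ?_⟩
    · exact (min_le_left _ _).trans (min_le_left _ _)
    · exact (min_le_left _ _).trans (min_le_right _ _)
    · linarith [min_le_right (min δ (ε / 2)) (min m₁ m₂ / 5), min_le_left m₁ m₂]
    · linarith [min_le_right (min δ (ε / 2)) (min m₁ m₂ / 5), min_le_right m₁ m₂]
  filter_upwards [eventually_close (γ, l) hκ]
  rintro ⟨γ', l'⟩ ⟨⟨φ, hφ⟩, hl⟩
  dsimp only at φ hφ hl ⊢
  have := Metric.instTietzeExtensionClosedBall ℝ (0 : ℂ) hκ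
  -- Tietze extends the displacement along `γ` to the plane with the same bound `κ`, so `z + W z`
  -- carries `γ` to `γ' ∘ φ`; the image of the arc plays no further role.
  obtain ⟨W, hWκ, hW⟩ := ContinuousMap.exists_extension_forall_mem γ.isClosedEmbedding_toMap
    (⟨fun s => γ'.1.toMap (φ s) - γ.1.toMap s,
      (γ'.1.toMap.continuous.comp φ.continuous).sub γ.1.toMap.continuous⟩ :
      C(Set.Icc (0 : ℝ) γ.1.duration, ℂ)) (t := Metric.closedBall 0 κ)
    fun s => by simpa using (hφ.norm_sub_lt s).le
  have hWγ : ∀ s, W (γ.1.toMap s) = γ'.1.toMap (φ s) - γ.1.toMap s := fun s =>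
    congrArg (fun f => f s) hW
  replace hWκ : ∀ z, ‖W z‖ ≤ κ := fun z => by simpa using hWκ z
  have hsub : Set.uIcc a b ⊆ Set.Icc 0 l.1.duration ∩ Set.Icc (θ - ε₁ / 2) (θ + ε₁ / 2) :=
    Set.subset_inter (Set.uIcc_subset_Icc ha0 hb0) (Set.uIcc_subset_Icc ha hb)
  obtain ⟨z, hzK, t, ht, hzt⟩ := exists_mem_of_separates hK haL.1 hbR.1 haL.2 hbR.2
    (f := fun z => z + W z) (by fun_prop) (S := l'.1.eval '' Set.uIcc a b)
    (isPreconnected_uIcc.image _ l'.1.continuous_eval.continuousOn)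
    (Set.mem_image_of_mem _ Set.left_mem_uIcc) (Set.mem_image_of_mem _ Set.right_mem_uIcc)
    (fun z hz => by
      rw [add_sub_cancel_left]
      linarith [hWκ z, hl.norm_sub_lt a ha0.1, hm₁K z hz])
    (fun z hz => by
      rw [add_sub_cancel_left]
      linarith [hWκ z, hl.norm_sub_lt b hb0.1, hm₂K z hz])
  have hzx : ‖z - x‖ < 3 * δ := by
    have h1 : ‖l.1.eval t - x‖ < δ := by
      rw [← hlθ, ← dist_eq_norm]
      refine hlδ ?_
      rw [Real.dist_eq, abs_lt]
      constructor <;> linarith [(hsub ht).2.1, (hsub ht).2.2]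
    have h2 := hl.norm_sub_lt t (hsub ht).1.1
    have h3 : z - x = (l'.1.eval t - l.1.eval t) + (l.1.eval t - x) - W z := by
      rw [hzt]
      ring
    rw [h3]
    linarith [norm_sub_le ((l'.1.eval t - l.1.eval t) + (l.1.eval t - x)) (W z),
      norm_add_le (l'.1.eval t - l.1.eval t) (l.1.eval t - x), hWκ z]
  rcases hzK with ⟨s, -, rfl⟩ | harc
  -- Since `eval` is constant outside the time interval, `s` can be clamped to it; nothing need be
  -- known about where the entry and exit times lie.
  · rw [γ.1.eval_eq_toMap_projIcc] at hzt hzx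
    set s₀ := Set.projIcc 0 γ.1.duration γ.1.duration_nonneg s
    rw [hWγ, add_sub_cancel] at hzt
    have h1 : |(s₀ : ℝ) - σ| < ε / 2 := by
      refine hδσ s₀ s₀.2 ?_
      rw [Curve.eval_coe, hxσ]
      linarith
    refine ⟨φ s₀, ⟨(φ s₀).2, ?_⟩, ?_⟩
    · rw [Curve.eval_coe, ← hzt]
      exact l'.1.eval_mem_range t
    · linarith [abs_sub_le (φ s₀ : ℝ) s₀ σ, hφ.abs_sub_lt s₀]
  · rw [norm_sub_of_mem_ccwArc harc] at hzx
    linarith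

/-- Near any pair, the path does not hit the loop long before the first hitting
time. -/
theorem eventually_forall_lt_hit (p : SimplePath × Loop) {ε : ℝ} (hε : 0 < ε) :
    ∀ᶠ q in 𝓝 p, ∀ s ∈ hittingTimes q.1 q.2, firstHit p.1 p.2 - ε < s := by
  obtain ⟨γ, l⟩ := p
  dsimp only
  set σ := firstHit γ l with hσ
  have hA : IsCompact (γ.1.eval '' (Set.Icc 0 γ.1.duration ∩ Set.Iic (σ - ε / 2))) :=
    (isCompact_Icc.inter_right isClosed_Iic).image γ.1.continuous_eval
  have hdisj : Disjoint (γ.1.eval '' (Set.Icc 0 γ.1.duration ∩ Set.Iic (σ - ε / 2))) l.1.range := by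
    rw [Set.disjoint_left]
    rintro _ ⟨s, ⟨hs, hsσ⟩, rfl⟩ hsl
    have h1 : σ ≤ s := csInf_le ⟨0, fun s hs => hs.1.1⟩ ⟨hs, hsl⟩
    rw [Set.mem_Iic] at hsσ
    linarith
  obtain ⟨m, hm, hmd⟩ := Metric.exists_pos_forall_lt_edist hA l.1.isCompact_range.isClosed hdisj
  have hm' : (0 : ℝ) < m := by exact_mod_cast hm
  -- A hit at time at most `σ - ε` pulls back to a time at most `σ - ε / 2` on `γ`, and the two
  -- errors below `m / 2` contradict the distance `m` between this initial piece and the loop.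
  filter_upwards [eventually_close (γ, l) (lt_min (half_pos hε) (half_pos hm'))]
  rintro ⟨γ', l'⟩ ⟨⟨φ, hφ⟩, hl⟩ s ⟨hs, t, hst⟩
  dsimp only at φ hφ hl hst hs
  by_contra! hcon
  obtain ⟨s₀, hs₀⟩ := φ.surjective ⟨s, hs⟩
  have h1 := hφ.abs_sub_lt s₀
  have h2 := hφ.norm_sub_lt s₀
  have h3 := hl.norm_sub_lt t t.2.1
  have hval : γ'.1.toMap (φ s₀) = l'.1.toMap t := by
    rw [hs₀, hst, Curve.eval_of_mem]
  rw [hs₀, lt_min_iff, abs_lt, abs_lt] at h1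
  rw [hval, lt_min_iff] at h2
  rw [Curve.eval_coe, lt_min_iff] at h3
  have h4 := hmd (γ.1.eval s₀) ⟨s₀, ⟨s₀.2, by rw [Set.mem_Iic]; linarith [h1.1.1]⟩, rfl⟩
    (l.1.eval t) (l.1.eval_mem_range t)
  rw [edist_nndist, ENNReal.coe_lt_coe, ← NNReal.coe_lt_coe, coe_nndist, Curve.eval_coe] at h4
  have h5 := dist_triangle_left (γ.1.toMap s₀) (l.1.eval t) (l'.1.toMap t)
  rw [dist_eq_norm (l'.1.toMap t), dist_eq_norm (l'.1.toMap t)] at h5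
  linarith [h2.2, h3.2]

/-! ### Continuity of the first hitting time and of the roots. -/

theorem continuousWithinAt_firstHit {p : SimplePath × Loop} (hp : p ∈ regularPairs) :
    ContinuousWithinAt (fun q : SimplePath × Loop => firstHit q.1 q.2) intersectingPairs p := by
  refine Metric.tendsto_nhds.2 fun ε hε => ?_
  filter_upwards [mem_nhdsWithin_of_mem_nhds (eventually_exists_hit hp hε),
    mem_nhdsWithin_of_mem_nhds (eventually_forall_lt_hit p hε), self_mem_nhdsWithin]
  rintro q ⟨s, hs, hsε⟩ hlow hq
  have h1 := isLeast_firstHit hq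
  rw [Real.dist_eq, abs_lt]
  constructor <;> linarith [h1.2 hs, hlow _ h1.1, (abs_lt.1 hsε).2]

/-- The new root is pulled back by the time change to a point of the fixed path `p.1`, whose time is
close to the old hitting time; continuity of that path concludes. -/
theorem continuousWithinAt_spatialRoot {p : SimplePath × Loop} (hp : p ∈ regularPairs) :
    ContinuousWithinAt (fun q : SimplePath × Loop => spatialRoot q.1 q.2) intersectingPairs p := by
  refine Metric.tendsto_nhds.2 fun ε hε => ?_
  obtain ⟨δ, hδ, hcont⟩ := Metric.continuousAt_iff.1
    (p.1.1.continuous_eval.continuousAt (x := firstHit p.1 p.2)) (ε / 2) (half_pos hε)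
  filter_upwards [Metric.tendsto_nhds.1 (continuousWithinAt_firstHit hp) (δ / 2) (half_pos hδ),
    mem_nhdsWithin_of_mem_nhds (eventually_close p (lt_min (half_pos hδ) (half_pos hε))),
    self_mem_nhdsWithin]
  rintro q hσ ⟨⟨φ, hφ⟩, -⟩ hq
  obtain ⟨s, hs⟩ := φ.surjective ⟨firstHit q.1 q.2, (isLeast_firstHit hq).1.1⟩
  have h1 := hφ.abs_sub_lt s
  have h2 := hφ.norm_sub_lt s
  rw [hs, lt_min_iff] at h1 h2
  rw [← Curve.eval_coe, ← Curve.eval_coe, ← dist_eq_norm] at h2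
  rw [← Real.dist_eq, dist_comm] at h1
  have h3 : dist (p.1.1.eval s) (p.1.1.eval (firstHit p.1 p.2)) < ε / 2 :=
    hcont ((dist_triangle _ (firstHit q.1 q.2) _).trans_lt (by linarith [h1.1]))
  exact (dist_triangle _ (p.1.1.eval s) _).trans_lt
    ((add_lt_add h2.2 h3).trans_eq (add_halves ε))

/-- Near a regular pair, all temporal roots are close to the temporal root of the regular pair. -/
theorem eventually_temporalRoots_close {p : SimplePath × Loop} (hp : p ∈ regularPairs) {θ : ℝ}
    (hθ : temporalRoots p.1 p.2 = {θ}) {ε : ℝ} (hε : 0 < ε) :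
    ∀ᶠ q in 𝓝[intersectingPairs] p, ∀ t ∈ temporalRoots q.1 q.2, dist t θ < ε := by
  have hc : IsCompact (Set.Icc 0 p.2.1.duration ∩ {t | ε / 2 ≤ dist t θ}) :=
    isCompact_Icc.inter_right (isClosed_le continuous_const (by fun_prop))
  have hx : spatialRoot p.1 p.2 ∉
      p.2.1.eval '' (Set.Icc 0 p.2.1.duration ∩ {t | ε / 2 ≤ dist t θ}) := by
    rintro ⟨t, ⟨ht, htε⟩, h⟩
    have : t ∈ temporalRoots p.1 p.2 := ⟨ht, h⟩
    rw [hθ, Set.mem_singleton_iff] at this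
    rw [Set.mem_ofPred_eq, this, dist_self] at htε
    linarith
  obtain ⟨m, hm, hball⟩ := Metric.isOpen_iff.1
    (hc.image p.2.1.continuous_eval).isClosed.isOpen_compl _ hx
  filter_upwards [Metric.tendsto_nhds.1 (continuousWithinAt_spatialRoot hp) (m / 2) (half_pos hm),
    mem_nhdsWithin_of_mem_nhds (eventually_close p (lt_min (half_pos hε) (half_pos hm)))]
  rintro q hxq ⟨-, hl⟩ t ⟨ht, htx⟩
  have h1 := hl.norm_sub_lt t ht.1
  have h2 := hl.abs_sub_lt
  rw [lt_min_iff] at h1 h2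
  rw [htx, ← dist_eq_norm] at h1
  -- A root of the nearby loop may exceed the duration of `p.2`; clamping it leaves `eval` unchanged
  -- and moves time by less than the difference of durations allows.
  have h3 : dist (p.2.1.eval (min t p.2.1.duration)) (spatialRoot p.1 p.2) < m := by
    rw [Curve.eval_min _ ht.1]
    exact (dist_triangle_left _ _ (spatialRoot q.1 q.2)).trans_lt (by linarith [h1.2])
  have h4 : dist (min t p.2.1.duration) θ < ε / 2 := by
    by_contra! hcon
    exact hball h3 ⟨_, ⟨⟨le_min ht.1 p.2.1.duration_nonneg, min_le_right _ _⟩, hcon⟩, rfl⟩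
  have h5 : dist t (min t p.2.1.duration) < ε / 2 := by
    rw [Real.dist_eq, abs_of_nonneg (sub_nonneg.2 (min_le_left _ _))]
    rcases min_cases t p.2.1.duration with ⟨h, -⟩ | ⟨h, -⟩
    · rw [h]
      linarith
    · rw [h]
      linarith [ht.2, (abs_lt.1 h2.1).2]
  linarith [dist_triangle t (min t p.2.1.duration) θ]

/-- Any choice of a temporal root is continuous at the regular pairs. -/
theorem continuousWithinAt_of_mem_temporalRoots {p : SimplePath × Loop} (hp : p ∈ regularPairs)
    {τ : SimplePath → Loop → ℝ} (hτ : ∀ γ l, Intersects γ l → τ γ l ∈ temporalRoots γ l) :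
    ContinuousWithinAt (fun q : SimplePath × Loop => τ q.1 q.2) intersectingPairs p := by
  obtain ⟨hint, -, -, θ, hθ, -⟩ := id hp
  have hpθ : τ p.1 p.2 = θ := by
    have := hτ _ _ hint
    rwa [hθ] at this
  refine Metric.tendsto_nhds.2 fun ε hε => ?_
  filter_upwards [eventually_temporalRoots_close hp hθ hε, self_mem_nhdsWithin] with q hq hqi
  rw [hpθ]
  exact hq _ (hτ _ _ hqi)

theorem theorem3p2 :
    (∃ U : Set (SimplePath × Loop), IsOpen U ∧ regularPairs ⊆ U ∧ U ⊆ intersectingPairs) ∧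
    ∀ p ∈ regularPairs,
      ContinuousWithinAt (fun q : SimplePath × Loop => firstHit q.1 q.2) intersectingPairs p ∧
      ContinuousWithinAt (fun q : SimplePath × Loop => spatialRoot q.1 q.2) intersectingPairs p ∧
      ContinuousWithinAt (fun q : SimplePath × Loop => thetaMinus q.1 q.2) intersectingPairs p ∧
      ContinuousWithinAt (fun q : SimplePath × Loop => thetaPlus q.1 q.2) intersectingPairs p := by
  refine ⟨⟨interior intersectingPairs, isOpen_interior, fun p hp => ?_, interior_subset⟩,
    fun p hp => ⟨continuousWithinAt_firstHit hp, continuousWithinAt_spatialRoot hp,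
      continuousWithinAt_of_mem_temporalRoots hp fun _ _ h => (isLeast_thetaMinus h).1,
      continuousWithinAt_of_mem_temporalRoots hp fun _ _ h => (isGreatest_thetaPlus h).1⟩⟩
  rw [mem_interior_iff_mem_nhds]
  -- Any tolerance works: only the existence of a hit matters.
  filter_upwards [eventually_exists_hit hp one_pos]
  rintro q ⟨s, ⟨-, hs⟩, -⟩
  exact ⟨q.1.1.eval s, hs, q.1.1.eval_mem_range s⟩
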